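/- Let $n\ge 1$ and let $K\subset\mathbb{R}^n$ be a convex body, i.e. a compact convex set with non-empty interior. Write $\mathrm{D}(K)=\max\{\|x-y\| : x,y\in K\}$ for its Euclidean diameter, $K-K=\{x-y : x,y\in K\}$, and $$\mathrm{D}_K=\Big\{\tfrac{x-y}{\|x-y\|} : x,y\in K,\ \|x-y\|=\mathrm{D}(K)\Big\}\subseteq\mathbb{S}^{n-1}$$ for its set of diametrical directions. A convex body $L\subset\mathbb{R}^n$ is in Behrend position if $$\frac{\mathrm{vol}(L)}{\mathrm{D}(L)^n}=\max_{A\in\mathrm{GL}_n(\mathbb{R})}\frac{\mathrm{vol}(AL)}{\mathrm{D}(AL)^n},$$ and it is in Löwner position if the closed Euclidean unit ball is a minimum volume ellipsoid containing $L$ (ellipsoids are the sets $c+A\mathbb{B}$ with $c\in\mathbb{R}^n$, $A\in\mathrm{GL}_n(\mathbb{R})$ and $\mathbb{B}$ the closed Euclidean unit ball). A set said to be in one of these positions is in particular claimed to be a convex body. Then the following are equivalent: (i) $K$ is in Behrend position. (ii) $K-K$ is in Behrend position. (iii) $\frac{1}{\mathrm{D}(K)}(K-K)$ is in Löwner position.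 (iv) $\mathrm{conv}(\mathrm{D}_K)$ is in Löwner position. (v) There exist an integer $m$ with $n\le m\le\binom{n+1}{2}$, scalars $\lambda_1,\dots,\lambda_m\ge 0$ and diametrical directions $u_1,\dots,u_m\in\mathrm{D}_K$ such that $$\mathrm{I}_n=\sum_{i=1}^m\lambda_i u_i u_i^{\mathsf T}.$$ -/

import Mathlib

open scoped Pointwise

noncomputable section

/-- A convex body in `ℝⁿ`: a full-dimensional compact convex set. -/
def IsFullDimConvexBody {n : ℕ} (K : Set (EuclideanSpace ℝ (Fin n))) : Prop :=
  Convex ℝ K ∧ IsCompact K ∧ (interior K).Nonempty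

/-- The isodiametric quotient `vol(K) / D(K)ⁿ`. -/
def isodiametricQuotient {n : ℕ} (K : Set (EuclideanSpace ℝ (Fin n))) : ℝ :=
  (MeasureTheory.volume K).toReal / Metric.diam K ^ n

/-- The image `A K` of a set under an invertible matrix. -/
def linearImage {n : ℕ} (A : Matrix.GeneralLinearGroup (Fin n) ℝ)
    (K : Set (EuclideanSpace ℝ (Fin n))) : Set (EuclideanSpace ℝ (Fin n)) :=
  Matrix.toEuclideanLin (A : Matrix (Fin n) (Fin n) ℝ) '' K

/-- Behrend (isodiametric) position: `K` is a convex body whose isodiametric quotient is the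
maximum of the isodiametric quotients of its images under `GL_n(ℝ)`. -/
def IsBehrendPosition {n : ℕ} (K : Set (EuclideanSpace ℝ (Fin n))) : Prop :=
  IsFullDimConvexBody K ∧
    IsGreatest (Set.range fun A : Matrix.GeneralLinearGroup (Fin n) ℝ =>
      isodiametricQuotient (linearImage A K)) (isodiametricQuotient K)

/-- A (nondegenerate) ellipsoid: an image `c + A 𝔹` of the closed Euclidean unit ball. -/
def IsEllipsoid {n : ℕ} (E : Set (EuclideanSpace ℝ (Fin n))) : Prop :=
  ∃ (A : Matrix.GeneralLinearGroup (Fin n) ℝ) (c : EuclideanSpace ℝ (Fin n)),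
    E = c +ᵥ linearImage A (Metric.closedBall 0 1)

/-- `E` is a minimum volume ellipsoid containing `K`. -/
def IsMinVolumeEllipsoid {n : ℕ} (E K : Set (EuclideanSpace ℝ (Fin n))) : Prop :=
  IsEllipsoid E ∧ K ⊆ E ∧
    ∀ E' : Set (EuclideanSpace ℝ (Fin n)), IsEllipsoid E' → K ⊆ E' →
      MeasureTheory.volume E ≤ MeasureTheory.volume E'

/-- Löwner position: `K` is a convex body and the closed Euclidean unit ball is a minimum volume
ellipsoid containing `K`. -/
def IsLownerPosition {n : ℕ} (K : Set (EuclideanSpace ℝ (Fin n))) : Prop :=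
  IsFullDimConvexBody K ∧ IsMinVolumeEllipsoid (Metric.closedBall 0 1) K

/-- The set `D_K` of diametrical directions of `K`: the unit vectors `(x - y) / ‖x - y‖` with
`x, y ∈ K` and `‖x - y‖ = D(K)`. -/
def diametricalDirections {n : ℕ} (K : Set (EuclideanSpace ℝ (Fin n))) :
    Set (EuclideanSpace ℝ (Fin n)) :=
  {u | u ∈ Metric.sphere (0 : EuclideanSpace ℝ (Fin n)) 1 ∧
    ∃ x ∈ K, ∃ y ∈ K, ‖x - y‖ = Metric.diam K ∧ u = ‖x - y‖⁻¹ • (x - y)}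

end

/-! Everything is compared with one condition, `DetBounded (K - K) (diam K)`: a matrix taking `K -
K` into the ball of radius `D(K)` has `|det| ≤ 1`. Behrend position reduces to it by homogeneity,
and passing from `K` to `K - K` doubles both the diameter and the points to be controlled. For
Löwner position, an ellipsoid containing a symmetric set may be centred at the origin, and its
inverse matrix then maps the set into the unit ball.

Given `I = ∑ λᵢ uᵢuᵢᵀ`, a matrix with all `‖A uᵢ‖ ≤ 1` satisfies `tr AᵀA = ∑ λᵢ ‖A uᵢ‖² ≤ ∑ λᵢ = n`,
and AM-GM on the eigenvalues gives `|det A| ≤ 1` (`abs_det_le_one_of_sum_vecMulVec_eq_one`).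
Conversely, if `I / n` lies outside the convex hull of the `uuᵀ`, a separating `M` has `tr M < 0`
and `uᵀMu > 0`. For small `ε > 0`, `1 - εM` then keeps `K - K` in the ball but has determinant above
`1` (`DetBounded.hasIdentityDecomposition`). Carathéodory bounds the number of summands. -/

open Matrix in
/-- Every matrix that maps `Z` into the ball of radius `d` has determinant at most one in absolute
value. -/
def DetBounded {n : ℕ} (Z : Set (EuclideanSpace ℝ (Fin n))) (d : ℝ) : Prop :=
  ∀ A : Matrix (Fin n) (Fin n) ℝ, (∀ z ∈ Z, ‖toEuclideanLin A z‖ ≤ d) → |A.det| ≤ 1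

/-- The identity matrix is a nonnegative combination of the rank one matrices `u uᵀ`, `u ∈ U`, with
a number of summands between `n` and `n (n + 1) / 2`. -/
def HasIdentityDecomposition {n : ℕ} (U : Set (EuclideanSpace ℝ (Fin n))) : Prop :=
  ∃ m : ℕ, n ≤ m ∧ m ≤ (n + 1).choose 2 ∧
    ∃ (w : Fin m → ℝ) (u : Fin m → EuclideanSpace ℝ (Fin n)),
      (∀ i, 0 ≤ w i) ∧ (∀ i, u i ∈ U) ∧
      (1 : Matrix (Fin n) (Fin n) ℝ) = ∑ i, w i • Matrix.vecMulVec (u i) (u i)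

/-- In a finite-dimensional space, the convex hull of a compact set is compact. -/
theorem IsCompact.convexHull_of_finiteDimensional {E : Type*} [NormedAddCommGroup E]
    [NormedSpace ℝ E] [FiniteDimensional ℝ E] {s : Set E} (hs : IsCompact s) :
    IsCompact (convexHull ℝ s) := by
  let F : (k : ℕ) → (Fin k → ℝ) × (Fin k → E) → E := fun k p => ∑ i, p.1 i • p.2 i
  -- By Carathéodory, `dim E + 1` points suffice, so the hull is a finite union of continuous images
  -- of compact sets.
  have hF : convexHull ℝ s = ⋃ k ∈ Set.Iic (Module.finrank ℝ E + 1),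
      F k '' (stdSimplex ℝ (Fin k) ×ˢ Set.univ.pi fun _ => s) := by
    refine Set.Subset.antisymm (fun x hx => ?_) (Set.iUnion₂_subset fun k _ => ?_)
    · obtain ⟨ι, _, z, w, hz, hai, hw, hw1, hx⟩ := eq_pos_convex_span_of_mem_convexHull hx
      let e := Fintype.equivFin ι
      refine Set.mem_biUnion (Set.mem_Iic.mpr <|
          hai.card_le_finrank_succ.trans (Nat.add_le_add_right (Submodule.finrank_le _) 1))
        ⟨(w ∘ e.symm, z ∘ e.symm), ⟨⟨fun i => (hw _).le, ?_⟩, fun i _ => ?_⟩, ?_⟩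
      · exact (e.symm.sum_comp w).trans hw1
      · exact hz (Set.mem_range_self _)
      · exact (e.symm.sum_comp fun i => w i • z i).trans hx
    · rintro _ ⟨⟨w, z⟩, ⟨hw, hz⟩, rfl⟩
      exact (convex_convexHull ℝ s).sum_mem (fun i _ => hw.1 i) hw.2
        fun i _ => subset_convexHull ℝ s (hz i (Set.mem_univ i))
  rw [hF]
  refine (Set.finite_Iic _).isCompact_biUnion fun k _ => ?_
  exact ((isCompact_stdSimplex ℝ (Fin k)).prod (isCompact_univ_pi fun _ => hs)).image (by fun_prop)

/-! ### Trace, determinant and rank one matrices -/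

section Matrices

open Matrix

variable {n : ℕ}

lemma dotProduct_self_eq_norm_sq (x : EuclideanSpace ℝ (Fin n)) :
    dotProduct (x : Fin n → ℝ) x = ‖x‖ ^ 2 := by
  rw [EuclideanSpace.real_norm_sq_eq]
  simp [dotProduct, pow_two]

lemma dotProduct_transpose_mul_self_mulVec (A : Matrix (Fin n) (Fin n) ℝ)
    (x : EuclideanSpace ℝ (Fin n)) :
    dotProduct (x : Fin n → ℝ) ((Aᵀ * A) *ᵥ x) = ‖toEuclideanLin A x‖ ^ 2 := by
  rw [← dotProduct_self_eq_norm_sq, ← mulVec_mulVec, dotProduct_mulVec, vecMul_transpose]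
  rfl

lemma trace_mul_vecMulVec_self (A : Matrix (Fin n) (Fin n) ℝ) (x : Fin n → ℝ) :
    (A * vecMulVec x x).trace = dotProduct x (A *ᵥ x) := by
  rw [mul_vecMulVec, trace_vecMulVec, dotProduct_comm]

/-- AM-GM for the eigenvalues, obtained by multiplying the inequalities `x ≤ exp (x - 1)`. -/
lemma Matrix.PosSemidef.det_le_one_of_trace_le {S : Matrix (Fin n) (Fin n) ℝ} (hS : S.PosSemidef)
    (h : S.trace ≤ n) : S.det ≤ 1 := by
  have htr := hS.isHermitian.trace_eq_sum_eigenvalues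
  rw [hS.isHermitian.det_eq_prod_eigenvalues]
  simp only [RCLike.ofReal_real_eq_id, id] at htr ⊢
  calc ∏ i, hS.isHermitian.eigenvalues i
      ≤ ∏ i, Real.exp (hS.isHermitian.eigenvalues i - 1) :=
        Finset.prod_le_prod (fun i _ => hS.eigenvalues_nonneg i) fun i _ => by
          have := Real.add_one_le_exp (hS.isHermitian.eigenvalues i - 1)
          linarith
    _ = Real.exp (S.trace - n) := by
        rw [← Real.exp_sum, Finset.sum_sub_distrib, ← htr]; simp
    _ ≤ 1 := Real.exp_le_one_iff.mpr (by linarith)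

lemma abs_det_le_one_of_sum_vecMulVec_eq_one {ι : Type*} [Fintype ι] {w : ι → ℝ}
    {u : ι → EuclideanSpace ℝ (Fin n)} (hw : ∀ i, 0 ≤ w i) (hu : ∀ i, ‖u i‖ = 1)
    (h : (1 : Matrix (Fin n) (Fin n) ℝ) = ∑ i, w i • vecMulVec (u i) (u i))
    (A : Matrix (Fin n) (Fin n) ℝ) (hA : ∀ i, ‖toEuclideanLin A (u i)‖ ≤ 1) : |A.det| ≤ 1 := by
  have hsum : ∑ i, w i = n := by
    have := congrArg trace h
    simp only [trace_one, Fintype.card_fin, trace_sum, trace_smul, trace_vecMulVec,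
      dotProduct_self_eq_norm_sq, hu, smul_eq_mul] at this
    simpa using this.symm
  have htr : (Aᵀ * A).trace ≤ n := by
    have h1 : (Aᵀ * A).trace = ∑ i, w i * ‖toEuclideanLin A (u i)‖ ^ 2 := by
      rw [← mul_one (Aᵀ * A), h, Finset.mul_sum, trace_sum]
      refine Finset.sum_congr rfl fun i _ => ?_
      rw [Matrix.mul_smul, trace_smul, trace_mul_vecMulVec_self, dotProduct_transpose_mul_self_mulVec,
        smul_eq_mul]
    rw [h1, ← hsum]
    refine Finset.sum_le_sum fun i _ => ?_
    exact mul_le_of_le_one_right (hw i) (pow_le_one₀ (norm_nonneg _) (hA i))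
  have hS : (Aᵀ * A).PosSemidef := by
    simpa [conjTranspose_eq_transpose_of_trivial] using posSemidef_conjTranspose_mul_self A
  have hdet := hS.det_le_one_of_trace_le htr
  rw [det_mul, det_transpose, ← pow_two] at hdet
  exact (sq_le_one_iff_abs_le_one _).mp hdet

lemma span_eq_top_of_sum_vecMulVec_eq_one {ι : Type*} [Fintype ι] {w : ι → ℝ}
    {u : ι → EuclideanSpace ℝ (Fin n)}
    (h : (1 : Matrix (Fin n) (Fin n) ℝ) = ∑ i, w i • vecMulVec (u i) (u i)) :
    Submodule.span ℝ (Set.range u) = ⊤ := by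
  refine Submodule.eq_top_iff'.mpr fun x => ?_
  have hx : x = ∑ i, (w i * dotProduct (u i : Fin n → ℝ) x) • u i := by
    ext j
    have h1 : (x : Fin n → ℝ) = (1 : Matrix (Fin n) (Fin n) ℝ) *ᵥ x := by simp
    rw [h, sum_mulVec] at h1
    have h2 := congrFun h1 j
    rw [h2]
    simp only [smul_mulVec, vecMulVec_mulVec, Finset.sum_apply, Pi.smul_apply, WithLp.ofLp_sum,
      PiLp.smul_apply, smul_eq_mul, MulOpposite.smul_eq_mul_unop, MulOpposite.unop_op]
    exact Finset.sum_congr rfl fun i _ => by ring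
  rw [hx]
  exact Submodule.sum_mem _ fun i _ =>
    Submodule.smul_mem _ _ (Submodule.subset_span (Set.mem_range_self i))

/-- A linearly independent family of symmetric matrices has at most `n (n + 1) / 2` members. -/
lemma LinearIndependent.card_le_choose_of_isSymm {ι : Type*} [Fintype ι]
    {z : ι → Matrix (Fin n) (Fin n) ℝ} (hz : LinearIndependent ℝ z) (hs : ∀ i, (z i).IsSymm) :
    Fintype.card ι ≤ (n + 1).choose 2 := by
  -- Symmetrizing makes the entries functions of unordered pairs; on symmetric matrices `L` only
  -- doubles them, hence is injective there.
  let L : Matrix (Fin n) (Fin n) ℝ →ₗ[ℝ] (Sym2 (Fin n) → ℝ) :=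
    { toFun := fun M s => Sym2.lift ⟨fun i j => M i j + M j i, fun i j => add_comm _ _⟩ s
      map_add' := fun M N => by
        ext s; induction s with | _ i j => simp; ring
      map_smul' := fun c M => by
        ext s; induction s with | _ i j => simp; ring }
  have hL : LinearIndependent ℝ (L ∘ z) := by
    rw [Fintype.linearIndependent_iff] at hz ⊢
    intro g hg
    refine hz g ?_
    have hsymm : (∑ i, g i • z i).IsSymm := by
      simp only [IsSymm, transpose_sum, transpose_smul]
      exact Finset.sum_congr rfl fun i _ => by rw [(hs i).eq]
    have h0 : L (∑ i, g i • z i) = 0 := by simpa using hg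
    ext i j
    have h1 : (∑ i, g i • z i) i j + (∑ i, g i • z i) j i = 0 := congrFun h0 s(i, j)
    rw [hsymm.apply i j] at h1
    rw [Matrix.zero_apply]
    linarith
  have := hL.fintype_card_le_finrank
  simpa [Sym2.card] using this

end Matrices

/-! ### Decompositions of the identity and separation -/

section Decomposition

open Matrix

variable {n : ℕ} {U : Set (EuclideanSpace ℝ (Fin n))}

lemma HasIdentityDecomposition.detBounded (h : HasIdentityDecomposition U)
    (hU : ∀ u ∈ U, ‖u‖ = 1) : DetBounded U 1 := by
  obtain ⟨m, -, -, w, u, hw, hu, h1⟩ := h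
  exact fun A hA => abs_det_le_one_of_sum_vecMulVec_eq_one hw (fun i => hU _ (hu i)) h1 A
    fun i => hA _ (hu i)

lemma HasIdentityDecomposition.span_eq_top (h : HasIdentityDecomposition U) :
    Submodule.span ℝ U = ⊤ := by
  obtain ⟨m, -, -, w, u, -, hu, h1⟩ := h
  rw [eq_top_iff, ← span_eq_top_of_sum_vecMulVec_eq_one h1]
  exact Submodule.span_mono (Set.range_subset_iff.mpr hu)

/-- Carathéodory gives the upper bound on `m`; the lower bound holds because the vectors of a
decomposition span. -/
lemma hasIdentityDecomposition_of_mem_convexHull (hn : 1 ≤ n) (hU : ∀ u ∈ U, ‖u‖ = 1)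
    (h : (n : ℝ)⁻¹ • (1 : Matrix (Fin n) (Fin n) ℝ) ∈
      convexHull ℝ ((fun u : EuclideanSpace ℝ (Fin n) => vecMulVec (u : Fin n → ℝ) u) '' U)) :
    HasIdentityDecomposition U := by
  obtain ⟨ι, _, z, w, hz, hai, hw, -, hsum⟩ := eq_pos_convex_span_of_mem_convexHull h
  choose u huU hu using fun i => hz (Set.mem_range_self i)
  simp only at hu
  have htr : ∀ i, (z i).trace = 1 := fun i => by
    rw [← hu, trace_vecMulVec, dotProduct_self_eq_norm_sq, hU _ (huU i), one_pow]
  -- The `z i` lie in the hyperplane of trace one, which misses the origin, so affine independence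
  -- becomes linear independence and the bound needs no extra `+ 1`.
  have hli : LinearIndependent ℝ z := by
    rw [Fintype.linearIndependent_iff]
    intro g hg i
    have h0 : ∑ i, g i = 0 := by
      simpa [trace_sum, trace_smul, htr] using congrArg trace hg
    exact affineIndependent_iff.mp hai Finset.univ g h0 hg i (Finset.mem_univ i)
  have hn0 : (n : ℝ) ≠ 0 := by positivity
  have hone : (1 : Matrix (Fin n) (Fin n) ℝ) = ∑ i, (n * w i) • vecMulVec (u i) (u i) := by
    simp only [hu, mul_smul, ← Finset.smul_sum, hsum]
    rw [smul_smul, mul_inv_cancel₀ hn0, one_smul]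
  let e := Fintype.equivFin ι
  refine ⟨Fintype.card ι, ?_, hli.card_le_choose_of_isSymm fun i => ?_,
    fun i => n * w (e.symm i), fun i => u (e.symm i), fun i => ?_, fun i => huU _, ?_⟩
  · have h1 := finrank_range_le_card (R := ℝ) u
    rw [Set.finrank, span_eq_top_of_sum_vecMulVec_eq_one hone, finrank_top] at h1
    simpa using h1
  · rw [← hu, IsSymm, transpose_vecMulVec]
  · exact mul_nonneg (Nat.cast_nonneg _) (hw _).le
  · rw [hone]
    exact (e.symm.sum_comp fun i => (n * w i) • vecMulVec (u i : Fin n → ℝ) (u i)).symm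

/-- If `I / n` is not in the convex hull of the matrices `u uᵀ`, it is separated from them by a
matrix of negative trace whose quadratic form is positive on `U`. -/
lemma exists_trace_neg_of_notMem_convexHull (hn : 1 ≤ n) (hc : IsCompact U)
    (hU : ∀ u ∈ U, ‖u‖ = 1)
    (h : (n : ℝ)⁻¹ • (1 : Matrix (Fin n) (Fin n) ℝ) ∉
      convexHull ℝ ((fun u : EuclideanSpace ℝ (Fin n) => vecMulVec (u : Fin n → ℝ) u) '' U)) :
    ∃ M : Matrix (Fin n) (Fin n) ℝ, M.trace < 0 ∧
      ∀ u ∈ U, 0 < dotProduct (u : Fin n → ℝ) (M *ᵥ u) := by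
  have hcont : Continuous fun u : EuclideanSpace ℝ (Fin n) =>
      (fun i j => u i * u j : Fin n → Fin n → ℝ) := by fun_prop
  have hcl : IsClosed (convexHull ℝ
      ((fun u : EuclideanSpace ℝ (Fin n) => (fun i j => u i * u j : Fin n → Fin n → ℝ)) '' U)) :=
    (IsCompact.image hc hcont).convexHull_of_finiteDimensional.isClosed
  obtain ⟨f, c, hf1, hf2⟩ := geometric_hahn_banach_point_closed
    (E := Fin n → Fin n → ℝ) (convex_convexHull ℝ _) hcl h
  have hfX : ∀ X : Fin n → Fin n → ℝ,
      f X = ∑ i, ∑ j, X i j * f (Pi.single i (Pi.single j 1)) := fun X => by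
    have hX : X = ∑ i, ∑ j, X i j • (Pi.single i (Pi.single j 1) : Fin n → Fin n → ℝ) := by
      ext a b
      simp [Finset.sum_apply, Pi.single_apply, ite_apply]
    conv_lhs => rw [hX]
    simp [map_sum]
  let M : Matrix (Fin n) (Fin n) ℝ := of fun i j => f (Pi.single i (Pi.single j 1))
  have hn0 : (0 : ℝ) < n := by positivity
  -- Since `uᵀu = 1` and `tr (I / n) = 1`, subtracting `c • 1` moves the separation threshold from
  -- `c` to `0`.
  refine ⟨M - c • 1, ?_, fun u hu => ?_⟩
  · have h1 : f ((n : ℝ)⁻¹ • (1 : Matrix (Fin n) (Fin n) ℝ)) = (n : ℝ)⁻¹ * M.trace := by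
      refine (hfX _).trans ?_
      simp [M, trace, one_apply, Finset.mul_sum]
    have h2 : (n : ℝ)⁻¹ * M.trace < c := h1 ▸ hf1
    rw [inv_mul_lt_iff₀ hn0] at h2
    simp only [trace_sub, trace_smul, trace_one, Fintype.card_fin, smul_eq_mul]
    linarith
  · have h1 : c < f (fun i j => u i * u j) :=
      hf2 _ (subset_convexHull ℝ _ (Set.mem_image_of_mem _ hu))
    have h2 : f (fun i j => u i * u j) = dotProduct (u : Fin n → ℝ) (M *ᵥ u) := by
      rw [hfX]
      simp only [dotProduct, mulVec, Finset.mul_sum, M, of_apply]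
      exact Finset.sum_congr rfl fun i _ => Finset.sum_congr rfl fun j _ => by ring
    rw [sub_mulVec, dotProduct_sub, smul_mulVec, one_mulVec, dotProduct_smul,
      dotProduct_self_eq_norm_sq, hU u hu, ← h2]
    simpa using h1

end Decomposition

/-! ### First order perturbation of the identity -/

section Perturbation

open Matrix Filter Topology

variable {n : ℕ}

lemma norm_toEuclideanLin_one_sub_smul_sq (M : Matrix (Fin n) (Fin n) ℝ) (ε : ℝ)
    (z : EuclideanSpace ℝ (Fin n)) :
    ‖toEuclideanLin (1 - ε • M) z‖ ^ 2 =
      ‖z‖ ^ 2 + ε * (ε * ‖toEuclideanLin M z‖ ^ 2 - 2 * dotProduct (z : Fin n → ℝ) (M *ᵥ z)) := by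
  have h : toEuclideanLin (1 - ε • M) z = z - ε • toEuclideanLin M z := by
    rw [map_sub, map_smul, toLpLin_one]; rfl
  have h2 : inner ℝ z (toEuclideanLin M z) = dotProduct (z : Fin n → ℝ) (M *ᵥ z) := by
    rw [EuclideanSpace.inner_eq_star_dotProduct, star_trivial, dotProduct_comm]
    rfl
  rw [h, norm_sub_sq_real, inner_smul_right, h2, norm_smul, mul_pow, Real.norm_eq_abs, sq_abs]
  ring

/-- The expansion `det (1 - εM) = 1 - ε tr M + O(ε²)`, with a polynomial remainder. -/
lemma eventually_one_lt_det_one_sub_smul {M : Matrix (Fin n) (Fin n) ℝ} (hM : M.trace < 0) :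
    ∀ᶠ ε : ℝ in 𝓝[>] 0, 1 < (1 - ε • M).det := by
  obtain ⟨p, hp⟩ : ∃ p : Polynomial ℝ, ∀ ε : ℝ,
      (1 - ε • M).det = 1 + ε * (-M.trace + p.eval ε * ε) := by
    refine ⟨(det (1 + (Polynomial.X : Polynomial ℝ) • (-M).map Polynomial.C)).divX.divX,
      fun ε => ?_⟩
    rw [sub_eq_add_neg, ← smul_neg, det_one_add_smul, trace_neg]
    ring
  have hlim : ∀ᶠ ε : ℝ in 𝓝 0, 0 < -M.trace + p.eval ε * ε := by
    have hc : Continuous fun ε : ℝ => -M.trace + p.eval ε * ε := by fun_prop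
    exact (hc.tendsto 0).eventually_const_lt (by simpa using hM)
  filter_upwards [hlim.filter_mono nhdsWithin_le_nhds, self_mem_nhdsWithin] with ε h1 h2
  rw [hp]
  linarith [mul_pos (Set.mem_Ioi.mp h2) h1]

/-- Points of norm below `d` have room to move; at norm `d` the first order term `-2ε zᵀMz` is
negative. Compactness makes the choice of `ε` uniform. -/
lemma eventually_norm_toEuclideanLin_one_sub_smul_le {Z : Set (EuclideanSpace ℝ (Fin n))} {d : ℝ}
    (hd : 0 ≤ d) (hZ : IsCompact Z) (hle : ∀ z ∈ Z, ‖z‖ ≤ d) {M : Matrix (Fin n) (Fin n) ℝ}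
    (hM : ∀ z ∈ Z, ‖z‖ = d → 0 < dotProduct (z : Fin n → ℝ) (M *ᵥ z)) :
    ∀ᶠ ε : ℝ in 𝓝[>] 0, ∀ z ∈ Z, ‖toEuclideanLin (1 - ε • M) z‖ ≤ d := by
  have hL : Continuous (toEuclideanLin M) := LinearMap.continuous_of_finiteDimensional _
  have hq : Continuous fun p : ℝ × EuclideanSpace ℝ (Fin n) =>
      p.1 * ‖toEuclideanLin M p.2‖ ^ 2 - 2 * dotProduct (p.2 : Fin n → ℝ) (M *ᵥ p.2) := by
    have h1 : Continuous fun p : ℝ × EuclideanSpace ℝ (Fin n) => toEuclideanLin M p.2 :=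
      hL.comp continuous_snd
    have h2 : Continuous fun p : ℝ × EuclideanSpace ℝ (Fin n) =>
        dotProduct (p.2 : Fin n → ℝ) (M *ᵥ p.2) := by
      unfold mulVec dotProduct
      fun_prop
    fun_prop
  -- The repeated `z ∈ Z` survives localization: the local statement ranges over all points near
  -- `z₀`, but `‖z‖ ≤ d` is known only on `Z`.
  have key : ∀ᶠ ε : ℝ in 𝓝 0, ∀ z ∈ Z, 0 < ε → z ∈ Z →
      ‖toEuclideanLin (1 - ε • M) z‖ ≤ d := by
    refine hZ.eventually_forall_of_forall_eventually fun z₀ hz₀ => ?_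
    rcases (hle z₀ hz₀).lt_or_eq with h | h
    · have hc : Continuous fun p : ℝ × EuclideanSpace ℝ (Fin n) => ‖p.2‖ ^ 2 + p.1 *
          (p.1 * ‖toEuclideanLin M p.2‖ ^ 2 - 2 * dotProduct (p.2 : Fin n → ℝ) (M *ᵥ p.2)) :=
        (by fun_prop : Continuous fun p : ℝ × EuclideanSpace ℝ (Fin n) => ‖p.2‖ ^ 2).add
          (continuous_fst.mul hq)
      have h0 := (hc.tendsto (0, z₀)).eventually_lt_const (u := d ^ 2)
        (by simpa using pow_lt_pow_left₀ h (norm_nonneg _) two_ne_zero)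
      filter_upwards [h0] with p hp _ _
      rw [← norm_toEuclideanLin_one_sub_smul_sq] at hp
      exact (pow_le_pow_iff_left₀ (norm_nonneg _) hd two_ne_zero).mp hp.le
    · have h0 := (hq.tendsto (0, z₀)).eventually_lt_const (u := 0)
        (by simpa using hM z₀ hz₀ h)
      filter_upwards [h0] with p hp hpos hpZ
      refine (pow_le_pow_iff_left₀ (norm_nonneg _) hd two_ne_zero).mp ?_
      rw [norm_toEuclideanLin_one_sub_smul_sq]
      nlinarith [pow_le_pow_left₀ (norm_nonneg _) (hle _ hpZ) 2, mul_neg_of_pos_of_neg hpos hp]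
  filter_upwards [key.filter_mono nhdsWithin_le_nhds, self_mem_nhdsWithin] with ε h1 h2 z hz
  exact h1 z hz h2 hz

lemma DetBounded.mono {Z W : Set (EuclideanSpace ℝ (Fin n))} {d : ℝ} (h : DetBounded Z d)
    (hZW : Z ⊆ W) : DetBounded W d :=
  fun A hA => h A fun z hz => hA z (hZW hz)

lemma detBounded_smul_iff {Z : Set (EuclideanSpace ℝ (Fin n))} {c d : ℝ} (hc : 0 < c) :
    DetBounded (c • Z) (c * d) ↔ DetBounded Z d := by
  refine forall_congr' fun A => imp_congr_left ?_
  simp only [← Set.image_smul, Set.forall_mem_image, map_smul, norm_smul,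
    Real.norm_of_nonneg hc.le, mul_le_mul_iff_right₀ hc]

/-- If the determinant bound holds for a compact set `Z`, then the unit vectors in the directions
of the points of `Z` of maximal norm decompose the identity. -/
lemma DetBounded.hasIdentityDecomposition (hn : 1 ≤ n) {Z U : Set (EuclideanSpace ℝ (Fin n))}
    {d : ℝ} (hd : 0 < d) (hZ : IsCompact Z) (hle : ∀ z ∈ Z, ‖z‖ ≤ d) (hUc : IsCompact U)
    (hU : ∀ u ∈ U, ‖u‖ = 1) (hZU : ∀ z ∈ Z, ‖z‖ = d → d⁻¹ • z ∈ U) (h : DetBounded Z d) :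
    HasIdentityDecomposition U := by
  refine hasIdentityDecomposition_of_mem_convexHull hn hU ?_
  by_contra hmem
  obtain ⟨M, htr, hM⟩ := exists_trace_neg_of_notMem_convexHull hn hUc hU hmem
  have hM' : ∀ z ∈ Z, ‖z‖ = d → 0 < dotProduct (z : Fin n → ℝ) (M *ᵥ z) := fun z hz hzd => by
    have h1 := hM _ (hZU z hz hzd)
    rw [WithLp.ofLp_smul, mulVec_smul, smul_dotProduct, dotProduct_smul, smul_eq_mul, smul_eq_mul,
      ← mul_assoc] at h1
    exact pos_of_mul_pos_right h1 (by positivity)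
  obtain ⟨ε, h1, h2⟩ := ((eventually_one_lt_det_one_sub_smul htr).and
    (eventually_norm_toEuclideanLin_one_sub_smul_le hd.le hZ hle hM')).exists
  exact absurd ((le_abs_self _).trans (h _ h2)) h1.not_ge

end Perturbation

/-! ### Behrend and Löwner positions as determinant bounds -/

section Positions

open MeasureTheory

variable {n : ℕ} {K L : Set (EuclideanSpace ℝ (Fin n))}

lemma linearImage_one (K : Set (EuclideanSpace ℝ (Fin n))) : linearImage 1 K = K := by
  simp [linearImage]

lemma volume_linearImage (A : Matrix.GeneralLinearGroup (Fin n) ℝ)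
    (K : Set (EuclideanSpace ℝ (Fin n))) :
    volume (linearImage A K) =
      ENNReal.ofReal |(A : Matrix (Fin n) (Fin n) ℝ).det| * volume K := by
  rw [linearImage, Measure.addHaar_image_linearMap, LinearMap.det_toLpLin]

lemma isCompact_sub_self (hK : IsCompact K) : IsCompact (K - K) := by
  rw [← Set.sub_image_prod]
  exact (hK.prod hK).image continuous_sub

lemma norm_sub_le_diam (hK : IsCompact K) {x y : EuclideanSpace ℝ (Fin n)} (hx : x ∈ K)
    (hy : y ∈ K) : ‖x - y‖ ≤ Metric.diam K := by
  rw [← dist_eq_norm]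
  exact Metric.dist_le_diam_of_mem hK.isBounded hx hy

lemma norm_le_diam_of_mem_sub (hK : IsCompact K) {z : EuclideanSpace ℝ (Fin n)}
    (hz : z ∈ K - K) : ‖z‖ ≤ Metric.diam K := by
  obtain ⟨x, hx, y, hy, rfl⟩ := Set.mem_sub.mp hz
  exact norm_sub_le_diam hK hx hy

lemma isCompact_linearImage (hK : IsCompact K) (A : Matrix.GeneralLinearGroup (Fin n) ℝ) :
    IsCompact (linearImage A K) :=
  hK.image (LinearMap.continuous_of_finiteDimensional _)

lemma diam_linearImage_le_iff (hK : IsCompact K) (A : Matrix.GeneralLinearGroup (Fin n) ℝ) {d : ℝ}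
    (hd : 0 ≤ d) : Metric.diam (linearImage A K) ≤ d ↔
      ∀ z ∈ K - K, ‖Matrix.toEuclideanLin (A : Matrix (Fin n) (Fin n) ℝ) z‖ ≤ d := by
  constructor
  · rintro h z hz
    obtain ⟨x, hx, y, hy, rfl⟩ := Set.mem_sub.mp hz
    rw [map_sub]
    exact (norm_sub_le_diam (isCompact_linearImage hK A) (Set.mem_image_of_mem _ hx)
      (Set.mem_image_of_mem _ hy)).trans h
  · refine fun h => Metric.diam_le_of_forall_dist_le hd ?_
    rintro _ ⟨x, hx, rfl⟩ _ ⟨y, hy, rfl⟩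
    rw [dist_eq_norm, ← map_sub]
    exact h _ (Set.sub_mem_sub hx hy)

lemma IsFullDimConvexBody.diam_pos (hn : 1 ≤ n) (hK : IsFullDimConvexBody K) :
    0 < Metric.diam K := by
  have : Nonempty (Fin n) := ⟨⟨0, hn⟩⟩
  refine Metric.diam_pos ?_ hK.2.1.isBounded
  obtain ⟨x, hx⟩ := hK.2.2
  exact (infinite_of_mem_nhds x (mem_interior_iff_mem_nhds.mp hx)).nontrivial

lemma IsFullDimConvexBody.volume_pos (hK : IsFullDimConvexBody K) : 0 < (volume K).toReal :=
  ENNReal.toReal_pos (Measure.measure_pos_of_nonempty_interior _ hK.2.2).ne'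
    hK.2.1.measure_lt_top.ne

lemma IsFullDimConvexBody.sub_self (hK : IsFullDimConvexBody K) :
    IsFullDimConvexBody (K - K) := by
  refine ⟨hK.1.sub hK.1, isCompact_sub_self hK.2.1, ?_⟩
  have h : interior K - K ⊆ interior (K - K) :=
    interior_maximal (Set.sub_subset_sub_right interior_subset) isOpen_interior.sub_right
  exact (hK.2.2.sub (hK.2.2.mono interior_subset)).mono h

lemma IsFullDimConvexBody.smul (hK : IsFullDimConvexBody K) {c : ℝ} (hc : c ≠ 0) :
    IsFullDimConvexBody (c • K) := by
  refine ⟨hK.1.smul c, hK.2.1.smul c, ?_⟩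
  rw [interior_smul₀ hc]
  exact hK.2.2.smul_set

lemma isodiametricQuotient_linearImage (A : Matrix.GeneralLinearGroup (Fin n) ℝ) :
    isodiametricQuotient (linearImage A K) = |(A : Matrix (Fin n) (Fin n) ℝ).det| *
      (volume K).toReal / Metric.diam (linearImage A K) ^ n := by
  rw [isodiametricQuotient, volume_linearImage, ENNReal.toReal_mul,
    ENNReal.toReal_ofReal (abs_nonneg _)]

lemma IsFullDimConvexBody.linearImage (hK : IsFullDimConvexBody K)
    (A : Matrix.GeneralLinearGroup (Fin n) ℝ) : IsFullDimConvexBody (linearImage A K) := by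
  refine ⟨hK.1.linear_image _, isCompact_linearImage hK.2.1 A, ?_⟩
  have hsurj : Function.Surjective
      (Matrix.toEuclideanLin (A : Matrix (Fin n) (Fin n) ℝ)) := fun y =>
    ⟨Matrix.toEuclideanLin (A⁻¹ : Matrix.GeneralLinearGroup (Fin n) ℝ).1 y, by
      rw [← LinearMap.comp_apply, ← Matrix.toLpLin_mul_same, ← Units.val_mul]
      simp⟩
  have hopen : IsOpenMap (Matrix.toEuclideanLin (A : Matrix (Fin n) (Fin n) ℝ)) :=
    LinearMap.isOpenMap_of_finiteDimensional _ hsurj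
  exact (hK.2.2.image _).mono (hopen.image_interior_subset K)

/-- Behrend position in terms of determinants. -/
lemma isBehrendPosition_iff_detBounded (hn : 1 ≤ n) (hK : IsFullDimConvexBody K) :
    IsBehrendPosition K ↔ DetBounded (K - K) (Metric.diam K) := by
  have hd := hK.diam_pos hn
  have hV := hK.volume_pos
  have hquot : ∀ A : Matrix.GeneralLinearGroup (Fin n) ℝ,
      isodiametricQuotient (_root_.linearImage A K) ≤ isodiametricQuotient K ↔
        |(A : Matrix (Fin n) (Fin n) ℝ).det| * Metric.diam K ^ n ≤
          Metric.diam (_root_.linearImage A K) ^ n := fun A => by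
    rw [isodiametricQuotient_linearImage, isodiametricQuotient,
      div_le_div_iff₀ (pow_pos ((hK.linearImage A).diam_pos hn) n) (pow_pos hd n),
      mul_right_comm, mul_comm (volume K).toReal, mul_le_mul_iff_left₀ hV]
  constructor
  · rintro ⟨-, -, hmax⟩ A hA
    rcases eq_or_ne A.det 0 with h0 | h0
    · simp [h0]
    have h1 := (hquot (Matrix.GeneralLinearGroup.mkOfDetNeZero A h0)).mp (hmax ⟨_, rfl⟩)
    have h2 := (diam_linearImage_le_iff hK.2.1
      (Matrix.GeneralLinearGroup.mkOfDetNeZero A h0) hd.le).mpr hA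
    have h3 := h1.trans (pow_le_pow_left₀ Metric.diam_nonneg h2 n)
    exact (mul_le_iff_le_one_left (pow_pos hd n)).mp h3
  · refine fun h => ⟨hK, ⟨1, by simp only [linearImage_one]⟩, ?_⟩
    rintro _ ⟨A, rfl⟩
    refine (hquot A).mpr ?_
    have hr := (hK.linearImage A).diam_pos hn
    set r := Metric.diam (_root_.linearImage A K)
    -- This factor rescales the image of `K` to have diameter `diam K`; its `n`-th power appears in
    -- the determinant and yields the quotient inequality.
    have h1 := h ((Metric.diam K / r) • (A : Matrix (Fin n) (Fin n) ℝ)) fun z hz => by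
      have h2 := (diam_linearImage_le_iff hK.2.1 A hr.le).mp le_rfl z hz
      rw [map_smul, LinearMap.smul_apply, norm_smul, Real.norm_of_nonneg (by positivity)]
      calc Metric.diam K / r * _ ≤ Metric.diam K / r * r := by gcongr
        _ = Metric.diam K := div_mul_cancel₀ _ hr.ne'
    rw [Matrix.det_smul, Fintype.card_fin, abs_mul, abs_of_nonneg (by positivity), div_pow,
      div_mul_eq_mul_div, div_le_one (pow_pos hr n)] at h1
    rwa [mul_comm]

lemma diam_sub_self (hK : IsCompact K) : Metric.diam (K - K) = 2 * Metric.diam K := by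
  refine le_antisymm (Metric.diam_le_of_forall_dist_le (by positivity) fun x hx y hy => ?_) ?_
  · rw [dist_eq_norm]
    linarith [norm_sub_le x y, norm_le_diam_of_mem_sub hK hx, norm_le_diam_of_mem_sub hK hy]
  · rw [← le_div_iff₀' two_pos]
    refine Metric.diam_le_of_forall_dist_le (by positivity) fun x hx y hy => ?_
    have h := norm_sub_le_diam (isCompact_sub_self hK) (Set.sub_mem_sub hx hy) (Set.sub_mem_sub hy hx)
    rw [← neg_sub x y, sub_neg_eq_add, ← two_smul ℝ, norm_smul, Real.norm_two] at h
    rw [dist_eq_norm]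
    linarith

/-- The two constraints on `A` agree: the triangle inequality gives one direction, and `(x - y) - (y
- x) = 2(x - y)` the other. -/
lemma detBounded_sub_sub_iff (d : ℝ) :
    DetBounded ((K - K) - (K - K)) (2 * d) ↔ DetBounded (K - K) d := by
  refine forall_congr' fun A => imp_congr_left ⟨fun h z hz => ?_, fun h z hz => ?_⟩
  · obtain ⟨x, hx, y, hy, rfl⟩ := Set.mem_sub.mp hz
    have h1 := h _ (Set.sub_mem_sub (Set.sub_mem_sub hx hy) (Set.sub_mem_sub hy hx))
    rw [← neg_sub x y, sub_neg_eq_add, ← two_smul ℝ, map_smul, norm_smul, Real.norm_two] at h1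
    linarith
  · obtain ⟨x, hx, y, hy, rfl⟩ := Set.mem_sub.mp hz
    rw [map_sub]
    linarith [norm_sub_le (Matrix.toEuclideanLin A x) (Matrix.toEuclideanLin A y), h x hx, h y hy]

/-- A point of an ellipsoid, expressed through the inverse matrix. -/
lemma mem_vadd_linearImage_closedBall_iff (A : Matrix.GeneralLinearGroup (Fin n) ℝ)
    (c x : EuclideanSpace ℝ (Fin n)) :
    x ∈ c +ᵥ linearImage A (Metric.closedBall 0 1) ↔
      ‖Matrix.toEuclideanLin (A⁻¹ : Matrix.GeneralLinearGroup (Fin n) ℝ).1 (x - c)‖ ≤ 1 := by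
  rw [Set.mem_vadd_set_iff_neg_vadd_mem, vadd_eq_add, neg_add_eq_sub, linearImage]
  have h1 : ∀ (B C : Matrix.GeneralLinearGroup (Fin n) ℝ) (y : EuclideanSpace ℝ (Fin n)),
      B * C = 1 → Matrix.toEuclideanLin B.1 (Matrix.toEuclideanLin C.1 y) = y :=
    fun B C y h => by
      rw [← LinearMap.comp_apply, ← Matrix.toLpLin_mul_same, ← Units.val_mul, h]
      simp
  constructor
  · rintro ⟨y, hy, hyx⟩
    rw [← hyx, h1 _ _ _ (inv_mul_cancel A)]
    simpa using hy
  · exact fun h => ⟨_, by simpa using h, h1 _ _ _ (mul_inv_cancel A)⟩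

lemma isEllipsoid_closedBall : IsEllipsoid (Metric.closedBall (0 : EuclideanSpace ℝ (Fin n)) 1) :=
  ⟨1, 0, by rw [zero_vadd, linearImage_one]⟩

lemma volume_closedBall_le_volume_ellipsoid_iff (A : Matrix.GeneralLinearGroup (Fin n) ℝ)
    (c : EuclideanSpace ℝ (Fin n)) :
    volume (Metric.closedBall (0 : EuclideanSpace ℝ (Fin n)) 1) ≤
        volume (c +ᵥ linearImage A (Metric.closedBall 0 1)) ↔
      |(A⁻¹ : Matrix.GeneralLinearGroup (Fin n) ℝ).1.det| ≤ 1 := by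
  have hpos : volume (Metric.closedBall (0 : EuclideanSpace ℝ (Fin n)) 1) ≠ 0 :=
    (Metric.measure_closedBall_pos _ _ one_pos).ne'
  have hfin : volume (Metric.closedBall (0 : EuclideanSpace ℝ (Fin n)) 1) ≠ ⊤ :=
    measure_closedBall_lt_top.ne
  have hdet : 0 < |(A : Matrix (Fin n) (Fin n) ℝ).det| := abs_pos.mpr
    ((Matrix.isUnit_iff_isUnit_det _).mp A.isUnit).ne_zero
  rw [measure_vadd, volume_linearImage, Matrix.coe_units_inv, Matrix.det_nonsing_inv,
    Ring.inverse_eq_inv', abs_inv, inv_le_one₀ hdet, ← ENNReal.one_le_ofReal]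
  nth_rw 1 [← one_mul (volume (Metric.closedBall (0 : EuclideanSpace ℝ (Fin n)) 1))]
  exact ENNReal.mul_le_mul_iff_left hpos hfin

/-- For origin-symmetric bodies in the unit ball, only ellipsoids centred at the origin matter. -/
lemma isLownerPosition_iff_detBounded (hL : IsFullDimConvexBody L) (hsymm : -L = L)
    (hball : ∀ x ∈ L, ‖x‖ ≤ 1) : IsLownerPosition L ↔ DetBounded L 1 := by
  constructor
  · rintro ⟨-, -, -, hmin⟩ A hA
    rcases eq_or_ne A.det 0 with h0 | h0
    · simp [h0]
    set G := Matrix.GeneralLinearGroup.mkOfDetNeZero A h0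
    have h1 := hmin _ ⟨G⁻¹, 0, rfl⟩ fun x hx => by
      rw [mem_vadd_linearImage_closedBall_iff, inv_inv, sub_zero]
      exact hA x hx
    rw [volume_closedBall_le_volume_ellipsoid_iff, inv_inv] at h1
    exact h1
  · refine fun h => ⟨hL, isEllipsoid_closedBall, fun x hx => by simpa using hball x hx, ?_⟩
    rintro _ ⟨A, c, rfl⟩ hsub
    rw [volume_closedBall_le_volume_ellipsoid_iff]
    refine h _ fun x hx => ?_
    have h1 := (mem_vadd_linearImage_closedBall_iff A c x).mp (hsub hx)
    have h2 := (mem_vadd_linearImage_closedBall_iff A c (-x)).mp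
      (hsub (by rw [← hsymm]; exact Set.neg_mem_neg.mpr hx))
    set T := Matrix.toEuclideanLin (A⁻¹ : Matrix.GeneralLinearGroup (Fin n) ℝ).1
    -- The centre `c` cancels between the bounds at `x` and `-x`.
    have h3 : (2 : ℝ) • T x = T (x - c) - T (-x - c) := by
      rw [← map_sub, ← map_smul]; congr 1; rw [two_smul]; abel
    have h4 := norm_sub_le (T (x - c)) (T (-x - c))
    rw [← h3, norm_smul, Real.norm_two] at h4
    linarith

lemma detBounded_convexHull_iff {U : Set (EuclideanSpace ℝ (Fin n))} {d : ℝ} :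
    DetBounded (convexHull ℝ U) d ↔ DetBounded U d := by
  refine ⟨fun h A hA => h A ?_, fun h => h.mono (subset_convexHull ℝ U)⟩
  have hconv : Convex ℝ (Matrix.toEuclideanLin A ⁻¹' Metric.closedBall 0 d) :=
    (convex_closedBall 0 d).linear_preimage _
  intro z hz
  simpa using convexHull_min (fun u hu => by simpa using hA u hu) hconv hz

end Positions

/-! ### Diametrical directions and their convex hull -/

section Directions

variable {n : ℕ} {K : Set (EuclideanSpace ℝ (Fin n))}

lemma norm_eq_one_of_mem_diametricalDirections {u : EuclideanSpace ℝ (Fin n)}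
    (hu : u ∈ diametricalDirections K) : ‖u‖ = 1 := by
  simpa using hu.1

/-- Exhibits `D_K` as the unit sphere cut by the rescaled difference body, whence its compactness.
-/
lemma mem_diametricalDirections_iff (hd : 0 < Metric.diam K) {u : EuclideanSpace ℝ (Fin n)} :
    u ∈ diametricalDirections K ↔ ‖u‖ = 1 ∧ Metric.diam K • u ∈ K - K := by
  constructor
  · rintro ⟨hu, x, hx, y, hy, hxy, rfl⟩
    refine ⟨by simpa using hu, ?_⟩
    rw [hxy, smul_inv_smul₀ hd.ne']
    exact Set.sub_mem_sub hx hy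
  · rintro ⟨hu, hmem⟩
    obtain ⟨x, hx, y, hy, hxy⟩ := Set.mem_sub.mp hmem
    have hn : ‖x - y‖ = Metric.diam K := by
      rw [hxy, norm_smul, hu, mul_one, Real.norm_of_nonneg hd.le]
    exact ⟨by simpa using hu, x, hx, y, hy, hn, by rw [hn, hxy, inv_smul_smul₀ hd.ne']⟩

lemma isCompact_diametricalDirections (hK : IsCompact K) (hd : 0 < Metric.diam K) :
    IsCompact (diametricalDirections K) := by
  have h : diametricalDirections K =
      Metric.sphere 0 1 ∩ (fun u => Metric.diam K • u) ⁻¹' (K - K) := by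
    ext u
    rw [mem_diametricalDirections_iff hd]
    simp
  rw [h]
  exact (isCompact_sphere 0 1).inter_right
    ((isCompact_sub_self hK).isClosed.preimage (continuous_const_smul _))

lemma neg_mem_diametricalDirections {u : EuclideanSpace ℝ (Fin n)}
    (hu : u ∈ diametricalDirections K) : -u ∈ diametricalDirections K := by
  obtain ⟨h1, x, hx, y, hy, hxy, rfl⟩ := hu
  refine ⟨by simpa using h1, y, hy, x, hx, by rw [norm_sub_rev, hxy], ?_⟩
  rw [norm_sub_rev y x, ← smul_neg, neg_sub]

lemma neg_diametricalDirections : -diametricalDirections K = diametricalDirections K := by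
  ext u
  rw [Set.mem_neg]
  exact ⟨fun h => by simpa using neg_mem_diametricalDirections h, neg_mem_diametricalDirections⟩

/-- The convex hull of a compact symmetric spanning set is a convex body. -/
lemma isFullDimConvexBody_convexHull (hn : 1 ≤ n) {U : Set (EuclideanSpace ℝ (Fin n))}
    (hU : IsCompact U) (hneg : ∀ u ∈ U, -u ∈ U) (hspan : Submodule.span ℝ U = ⊤) :
    IsFullDimConvexBody (convexHull ℝ U) := by
  refine ⟨convex_convexHull ℝ U, hU.convexHull_of_finiteDimensional, ?_⟩
  have : Nonempty (Fin n) := ⟨⟨0, hn⟩⟩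
  obtain ⟨u, hu⟩ : U.Nonempty := by
    rw [Set.nonempty_iff_ne_empty]
    rintro rfl
    rw [Submodule.span_empty] at hspan
    exact bot_ne_top hspan
  -- The origin is the midpoint of `u` and `-u`, so the affine span is the linear span.
  have h0 : (0 : EuclideanSpace ℝ (Fin n)) ∈ affineSpan ℝ U := by
    refine convexHull_subset_affineSpan (𝕜 := ℝ) U ?_
    have h := (convex_convexHull ℝ U) (subset_convexHull ℝ U hu)
      (subset_convexHull ℝ U (hneg u hu)) (by norm_num : (0 : ℝ) ≤ 1 / 2)
      (by norm_num : (0 : ℝ) ≤ 1 / 2) (by norm_num)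
    simpa using h
  rw [interior_convexHull_nonempty_iff_affineSpan_eq_top,
    ← affineSpan_insert_eq_affineSpan ℝ h0]
  refine SetLike.coe_injective ?_
  rw [affineSpan_insert_zero, hspan]
  rfl

end Directions

theorem mainTheorem3 {n : ℕ} (hn : 1 ≤ n) (K : Set (EuclideanSpace ℝ (Fin n)))
    (hK : IsFullDimConvexBody K) :
    List.TFAE [
      IsBehrendPosition K,
      IsBehrendPosition (K - K),
      IsLownerPosition ((1 / Metric.diam K) • (K - K)),
      IsLownerPosition (convexHull ℝ (diametricalDirections K)),
      ∃ m : ℕ, n ≤ m ∧ m ≤ (n + 1).choose 2 ∧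
        ∃ (w : Fin m → ℝ) (u : Fin m → EuclideanSpace ℝ (Fin n)),
          (∀ i, 0 ≤ w i) ∧ (∀ i, u i ∈ diametricalDirections K) ∧
          (1 : Matrix (Fin n) (Fin n) ℝ) = ∑ i, w i • Matrix.vecMulVec (u i) (u i)] := by
  have hd := hK.diam_pos hn
  have hKc := hK.2.1
  have hUc := isCompact_diametricalDirections hKc hd
  have hU : ∀ u ∈ diametricalDirections K, ‖u‖ = 1 :=
    fun u => norm_eq_one_of_mem_diametricalDirections
  have hUball : ∀ x ∈ convexHull ℝ (diametricalDirections K), ‖x‖ ≤ 1 := fun x hx => by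
    simpa using convexHull_min (fun u hu => by simpa using (hU u hu).le)
      (convex_closedBall (0 : EuclideanSpace ℝ (Fin n)) 1) hx
  have hUneg : -convexHull ℝ (diametricalDirections K) =
      convexHull ℝ (diametricalDirections K) := by
    rw [← convexHull_neg, neg_diametricalDirections]
  have hUsub : Metric.diam K • diametricalDirections K ⊆ K - K := by
    rintro _ ⟨u, hu, rfl⟩
    exact ((mem_diametricalDirections_iff hd).mp hu).2
  -- Only this direction is immediate, as `K - K` imposes more constraints on `A`; the converse goes
  -- through the decomposition of the identity.
  have hscale : DetBounded (diametricalDirections K) 1 → DetBounded (K - K) (Metric.diam K) := by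
    intro h
    rw [← detBounded_smul_iff hd, mul_one] at h
    exact h.mono hUsub
  have h1 := isBehrendPosition_iff_detBounded hn hK
  have h2 : IsBehrendPosition (K - K) ↔ DetBounded (K - K) (Metric.diam K) := by
    rw [isBehrendPosition_iff_detBounded hn hK.sub_self, diam_sub_self hKc, detBounded_sub_sub_iff]
  have h3 : IsLownerPosition ((1 / Metric.diam K) • (K - K)) ↔
      DetBounded (K - K) (Metric.diam K) := by
    have hpos : 0 < 1 / Metric.diam K := one_div_pos.mpr hd
    rw [isLownerPosition_iff_detBounded (hK.sub_self.smul hpos.ne'),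
      ← detBounded_smul_iff (Z := K - K) hpos, one_div_mul_cancel hd.ne']
    · rw [← Set.smul_set_neg, neg_sub]
    · rintro _ ⟨z, hz, rfl⟩
      rw [norm_smul, Real.norm_of_nonneg hpos.le, one_div_mul_eq_div, div_le_one hd]
      exact norm_le_diam_of_mem_sub hKc hz
  have h45 : IsLownerPosition (convexHull ℝ (diametricalDirections K)) →
      DetBounded (K - K) (Metric.diam K) := fun h =>
    hscale (detBounded_convexHull_iff.mp
      ((isLownerPosition_iff_detBounded h.1 hUneg hUball).mp h))
  -- The decomposition also forces `D_K` to span, which gives its hull the interior that Löwner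
  -- position demands.
  have h54 : HasIdentityDecomposition (diametricalDirections K) →
      IsLownerPosition (convexHull ℝ (diametricalDirections K)) := fun h =>
    (isLownerPosition_iff_detBounded
      (isFullDimConvexBody_convexHull hn hUc (fun u => neg_mem_diametricalDirections)
        h.span_eq_top) hUneg hUball).mpr (detBounded_convexHull_iff.mpr (h.detBounded hU))
  have h15 : DetBounded (K - K) (Metric.diam K) →
      HasIdentityDecomposition (diametricalDirections K) := fun h =>
    h.hasIdentityDecomposition hn hd (isCompact_sub_self hKc) (fun z => norm_le_diam_of_mem_sub hKc) hUc hU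
      fun z hz hzd => (mem_diametricalDirections_iff hd).mpr
        ⟨by rw [norm_smul, hzd, Real.norm_of_nonneg (inv_nonneg.mpr hd.le), inv_mul_cancel₀ hd.ne'],
          by rwa [smul_inv_smul₀ hd.ne']⟩
  tfae_have 1 ↔ 2 := h1.trans h2.symm
  tfae_have 1 ↔ 3 := h1.trans h3.symm
  tfae_have 1 → 5 := fun h => h15 (h1.mp h)
  tfae_have 5 → 4 := h54
  tfae_have 4 → 1 := fun h => h1.mpr (h45 h)
  tfae_finish
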